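/- Theorem 2.8 (I.3). Let $A$ be a Noetherian commutative ring, let $Y=\operatorname{Spec}(A)$, let $X$ be a ringed space (with a sheaf of commutative rings), and let $f\colon X\to Y$ be a morphism of ringed spaces. Assume that (1) $f$ is flat, i.e. for every $x\in X$ the homomorphism of stalks $\mathcal O_{Y,f(x)}\to\mathcal O_{X,x}$ is flat; (2) for every quasi-coherent (resp. coherent) $\mathcal O_Y$-module $F$ one has $H^1(X,f^*F)=0$. Then the canonical homomorphism $A=\Gamma(Y,\mathcal O_Y)\to\Gamma(X,\mathcal O_X)$ is flat. (These are two assertions: the conclusion holds if (2) is assumed for all quasi-coherent $\mathcal O_Y$-modules, and it also holds if (2) is assumed only for all coherent $\mathcal O_Y$-modules.) -/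

import Mathlib

open CategoryTheory TopologicalSpace Opposite AlgebraicGeometry

universe u

noncomputable section

namespace RingedSpaceModules

/-- The structure sheaf of a ringed space, as a sheaf of (not necessarily commutative) rings. -/
abbrev ringSheaf (X : RingedSpace.{u, u}) : TopCat.Sheaf RingCat.{u} X.carrier :=
  (sheafCompose _ (forget₂ CommRingCat.{u} RingCat.{u})).obj X.sheaf

/-- The category of `𝒪_X`-modules on a ringed space `X`. -/
abbrev OModule (X : RingedSpace.{u, u}) := SheafOfModules.{u} (ringSheaf X)

/-- The morphism of sheaves of rings `𝒪_Y ⟶ f_* 𝒪_X` of a morphism of ringed spaces. -/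
def comorphism {X Y : RingedSpace.{u, u}} (f : X ⟶ Y) :
    ringSheaf Y ⟶ ((Opens.map f.hom.base).sheafPushforwardContinuous
      RingCat.{u} _ _).obj (ringSheaf X) where
  hom := Functor.whiskerRight f.hom.c (forget₂ CommRingCat.{u} RingCat.{u})

/-- The direct image functor on modules of a morphism of small ringed sites has a left adjoint. -/
theorem isRightAdjoint_pushforward {C D : Type u} [Category.{u} C] [Category.{u} D]
    {J : GrothendieckTopology C} {K : GrothendieckTopology D} {F : C ⥤ D}
    {S : Sheaf J RingCat.{u}} {R : Sheaf K RingCat.{u}} [Functor.IsContinuous F J K]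
    (φ : S ⟶ (F.sheafPushforwardContinuous RingCat.{u} J K).obj R)
    [HasWeakSheafify K AddCommGrpCat.{u}] [K.WEqualsLocallyBijective AddCommGrpCat.{u}] :
    (SheafOfModules.pushforward.{u} φ).IsRightAdjoint := by
  have h : (PresheafOfModules.pushforward.{u}
    (show S.obj ⟶ F.op ⋙ R.obj from φ.hom)).IsRightAdjoint := inferInstance
  have : (PresheafOfModules.pushforward.{u} φ.hom).IsRightAdjoint := h
  infer_instance

/-- The direct image functor `f_*` on modules. -/
abbrev pushforward {X Y : RingedSpace.{u, u}} (f : X ⟶ Y) : OModule X ⥤ OModule Y :=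
  SheafOfModules.pushforward.{u} (comorphism f)

instance {X Y : RingedSpace.{u, u}} (f : X ⟶ Y) : (pushforward f).IsRightAdjoint :=
  isRightAdjoint_pushforward (comorphism f)

/-- The inverse image functor `f^*` on modules: the left adjoint of `f_*`. -/
def pullback {X Y : RingedSpace.{u, u}} (f : X ⟶ Y) : OModule Y ⥤ OModule X :=
  SheafOfModules.pullback.{u} (comorphism f)

/-- A morphism of ringed spaces is flat if all its stalk maps `𝒪_{Y,f(x)} ⟶ 𝒪_{X,x}` are flat. -/
def IsFlat {X Y : RingedSpace.{u, u}} (f : X ⟶ Y) : Prop :=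
  ∀ x : X, (f.hom.stalkMap x).hom.Flat

/-- The sheaf cohomology group `Hⁿ(X, F)` of (the abelian sheaf underlying) an `𝒪_X`-module. -/
abbrev Cohomology {X : RingedSpace.{u, u}} (F : OModule X) (n : ℕ) : Type u :=
  Sheaf.H.{u} ((SheafOfModules.toSheaf (ringSheaf X)).obj F) n

/-- `F` is quasi-coherent: locally it is the cokernel of a map of free modules (of any rank). -/
def IsQuasiCoherent {X : RingedSpace.{u, u}} (F : OModule X) : Prop :=
  SheafOfModules.IsQuasicoherent.{u} F

section Coherent

variable {X : RingedSpace.{u, u}}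

/-- The ring of sections `𝒪_X(U)`. -/
abbrev Fun (X : RingedSpace.{u, u}) (U : Opens X) : Type u := (ringSheaf X).obj.obj (op U)

/-- The `𝒪_X(U)`-module of sections `F(U)`. -/
abbrev Sec (F : OModule X) (U : Opens X) : Type u := F.val.obj (op U)

/-- Restriction of functions. -/
def resFun {U V : Opens X} (h : V ≤ U) (a : Fun X U) : Fun X V :=
  (ringSheaf X).obj.map (homOfLE h).op a

/-- Restriction of sections of a module. -/
def resSec (F : OModule X) {U V : Opens X} (h : V ≤ U) (s : Sec F U) : Sec F V :=
  F.val.map (homOfLE h).op s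

/-- `F` is of finite type: locally it is generated by finitely many sections. -/
def IsFiniteType (F : OModule X) : Prop :=
  ∀ x : X, ∃ (U : Opens X) (_ : x ∈ U) (n : ℕ) (s : Fin n → Sec F U),
    ∀ (V : Opens X) (hVU : V ≤ U) (t : Sec F V), ∀ y ∈ V,
      ∃ (W : Opens X) (hWV : W ≤ V) (_ : y ∈ W),
        resSec F hWV t ∈
          Submodule.span (Fun X W) (Set.range fun i => resSec F (hWV.trans hVU) (s i))

/-- The sheaf of relations between any finitely many sections `s₁, …, sₙ` of `F` over any open
set `U`, that is the kernel of the map `𝒪_U^n ⟶ F|_U` which they define, is of finite type. -/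
def HasFiniteTypeRelations (F : OModule X) : Prop :=
  ∀ (U : Opens X) (n : ℕ) (s : Fin n → Sec F U), ∀ x ∈ U,
    ∃ (V : Opens X) (hVU : V ≤ U) (_ : x ∈ V) (m : ℕ) (r : Fin m → Fin n → Fun X V),
      (∀ j, ∑ i, r j i • resSec F hVU (s i) = 0) ∧
      ∀ (W : Opens X) (hWV : W ≤ V) (a : Fin n → Fun X W),
        ∑ i, a i • resSec F (hWV.trans hVU) (s i) = 0 →
        ∀ y ∈ W, ∃ (W' : Opens X) (hW' : W' ≤ W) (_ : y ∈ W'),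
          (fun i => resFun hW' (a i)) ∈
            Submodule.span (Fun X W')
              (Set.range fun (j : Fin m) (i : Fin n) => resFun (hW'.trans hWV) (r j i))

/-- `F` is coherent: it is of finite type, and so is the sheaf of relations between any finitely
many sections of `F` over any open set. -/
def IsCoherent (F : OModule X) : Prop :=
  IsFiniteType F ∧ HasFiniteTypeRelations F

end Coherent

/-- The ringed space `Spec A`. -/
abbrev SpecRingedSpace (A : Type u) [CommRing A] : RingedSpace.{u, u} :=
  (Spec (CommRingCat.of A)).toSheafedSpace

/-- The canonical homomorphism `A = Γ(Spec A, 𝒪) ⟶ Γ(X, 𝒪_X)` of a morphism `f : X ⟶ Spec A`. -/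
def globalSectionsMap {A : Type u} [CommRing A] {X : RingedSpace.{u, u}}
    (f : X ⟶ SpecRingedSpace A) : A →+* X.presheaf.obj (op ⊤) :=
  ((Scheme.ΓSpecIso (CommRingCat.of A)).inv ≫ f.hom.c.app (op ⊤)).hom

end RingedSpaceModules

end

noncomputable section

open CategoryTheory.Limits Matrix

/-! By the equational criterion, flatness means that a solution b in Γ(X, 𝒪_X) of a linear equation
over A is a combination of solutions over A. As A is Noetherian, the column M of coefficients
extends to an exact sequence of finite free A-modules given by matrices Q, P, N, M acting on row
vectors.

Flat stalks keep the corresponding sequence of free 𝒪_X-modules exact (`StalksFlat.exact_mat`). So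
the kernel of N on X is the image of P, which is the cokernel G of Q. Right exactness of f^*
identifies G with the inverse image of the cokernel of Q on Spec A
(`exists_presentation_pullback_cokernel`). That cokernel is quasi-coherent, and also coherent
(`StalksFlat.isCoherent_cokernel`), so H¹(X, G) = 0 under either assumption.

Hence 0 → G → 𝒪^{I₂} → 𝒪^{I₁} → 𝒪 remains exact at 𝒪^{I₁} on global sections
(`StalksFlat.exists_global_vecMul_eq`). This gives b = tN, and NM = 0 says that the rows of N are
solutions over A. -/

/-- The whole space is terminal in every comma category involved. Finality is what makes the inverse
image of a free module free. -/
instance TopologicalSpace.Opens.final_map {X Y : TopCat.{u}} (f : X ⟶ Y) : (Opens.map f).Final where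
  out U := by
    have h : IsTerminal (StructuredArrow.mk (Y := (⊤ : Opens Y)) (T := Opens.map f)
        (homOfLE (show U ≤ (Opens.map f).obj ⊤ from fun _ _ => trivial))) :=
      IsTerminal.ofUniqueHom
        (fun S => StructuredArrow.homMk (homOfLE le_top) (Subsingleton.elim _ _))
        (fun S m => by ext; exact Subsingleton.elim _ _)
    have := h.hasTerminal
    exact isConnected_of_hasTerminal _

/-! ### Exactness of the passage from modules to abelian sheaves -/

namespace SheafOfModules

section Site

variable {C : Type u} [Category.{u} C] {J : GrothendieckTopology C} {R : Sheaf J RingCat.{u}}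
  [HasSheafify J AddCommGrpCat.{u}] [J.WEqualsLocallyBijective AddCommGrpCat.{u}]

/-- An epimorphism of sheaves of modules is locally surjective. -/
lemma isLocallySurjective_of_epi {M N : SheafOfModules.{u} R} (f : M ⟶ N) [Epi f] :
    PresheafOfModules.IsLocallySurjective J f.val := by
  let α := 𝟙 R.obj
  let adj := PresheafOfModules.sheafificationAdjunction α
  -- Factor through the presheaf image: `p` is surjective on sections, so only `i` has to be shown
  -- locally surjective.
  let i := Abelian.image.ι f.val
  let p := Abelian.factorThruImage f.val
  have hpi : p ≫ i = f.val := Abelian.image.fac f.val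
  have : Epi ((PresheafOfModules.sheafification α).map f.val) := by
    -- Sheafifying the presheaf map under `f` gives back `f`, up to the counit isomorphism.
    let G := (forget R ⋙ PresheafOfModules.restrictScalars α) ⋙ PresheafOfModules.sheafification α
    let e : G ≅ 𝟭 _ := asIso adj.counit
    have h : G.map f = e.hom.app M ≫ f ≫ e.inv.app N := (NatIso.naturality_2 e f).symm
    have : Epi (G.map f) := h ▸ inferInstance
    exact this
  have : Epi ((PresheafOfModules.sheafification α).map i) := by
    rw [← hpi, Functor.map_comp] at this
    exact epi_of_epi ((PresheafOfModules.sheafification α).map p) _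
  have : IsIso ((PresheafOfModules.sheafification α).map i) := isIso_of_mono_of_epi _
  have hW : J.W ((PresheafOfModules.toPresheaf _).map i) := by
    have h := PresheafOfModules.inverseImage_W_toPresheaf_eq_inverseImage_isomorphisms (J := J) α
    have h' : (MorphismProperty.isomorphisms _).inverseImage
        (PresheafOfModules.sheafification α) i := this
    rw [← h] at h'
    exact h'
  have := ((J.W_iff_isLocallyBijective _).1 hW).2
  have : PresheafOfModules.IsLocallySurjective J p :=
    Presheaf.isLocallySurjective_of_surjective J _
      (fun U => PresheafOfModules.surjective_of_epi p U)
  rw [← hpi, PresheafOfModules.IsLocallySurjective, Functor.map_comp]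
  infer_instance

instance : (toSheaf.{u} R).PreservesEpimorphisms where
  preserves f _ := by
    have : Sheaf.IsLocallySurjective ((toSheaf.{u} R).map f) := isLocallySurjective_of_epi f
    infer_instance

instance : PreservesFiniteColimits (toSheaf.{u} R) := by
  have h : (∀ S : ShortComplex (SheafOfModules.{u} R), S.ShortExact →
      (S.map (toSheaf.{u} R)).ShortExact) ↔ PreservesFiniteLimits (toSheaf.{u} R) ∧
        PreservesFiniteColimits (toSheaf.{u} R) := (toSheaf.{u} R).exact_tfae.out 0 3
  refine (h.1 fun S hS => ?_).2
  have h' := (toSheaf.{u} R).preservesFiniteLimits_iff_forall_exact_map_and_mono.1 inferInstance S hS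
  have := hS.epi_g
  exact { exact := h'.1, mono_f := h'.2, epi_g := inferInstanceAs (Epi ((toSheaf.{u} R).map S.g)) }

/-- Cohomology is that of the underlying abelian sheaf, so exact sequences of modules have to be
transported there. -/
instance : (toSheaf.{u} R).PreservesHomology := by
  have h : (toSheaf.{u} R).PreservesHomology ↔ PreservesFiniteLimits (toSheaf.{u} R) ∧
    PreservesFiniteColimits (toSheaf.{u} R) := (toSheaf.{u} R).exact_tfae.out 2 3
  exact h.2 ⟨inferInstance, inferInstance⟩

end Site

end SheafOfModules

/-! ### Epimorphisms and exactness in terms of local sections -/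

namespace RingedSpaceModules

variable {X : RingedSpace.{u, u}}

/-- The map on sections over `U` induced by a morphism of `𝒪_X`-modules. -/
abbrev appSec {F G : OModule X} (φ : F ⟶ G) (U : Opens X) : Sec F U →ₗ[Fun X U] Sec G U :=
  (φ.val.app (op U)).hom

lemma appSec_resSec {F G : OModule X} (φ : F ⟶ G) {U V : Opens X} (h : V ≤ U) (s : Sec F U) :
    appSec φ V (resSec F h s) = resSec G h (appSec φ U s) :=
  PresheafOfModules.naturality_apply φ.val (homOfLE h).op s

lemma appSec_comp {F G H : OModule X} (φ : F ⟶ G) (ψ : G ⟶ H) (U : Opens X) (s : Sec F U) :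
    appSec (φ ≫ ψ) U s = appSec ψ U (appSec φ U s) := rfl

lemma appSec_id (F : OModule X) (U : Opens X) (s : Sec F U) : appSec (𝟙 F) U s = s := rfl

lemma appSec_zero {F G : OModule X} (U : Opens X) (s : Sec F U) :
    appSec (0 : F ⟶ G) U s = 0 := rfl

lemma appSec_add {F G : OModule X} (φ ψ : F ⟶ G) (U : Opens X) (s : Sec F U) :
    appSec (φ + ψ) U s = appSec φ U s + appSec ψ U s := rfl

lemma appSec_sum {F G : OModule X} {ι : Type*} (t : Finset ι) (φ : ι → (F ⟶ G)) (U : Opens X)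
    (s : Sec F U) : appSec (∑ i ∈ t, φ i) U s = ∑ i ∈ t, appSec (φ i) U s := by
  classical
  induction t using Finset.induction_on with
  | empty => rfl
  | insert i t hi ih => rw [Finset.sum_insert hi, Finset.sum_insert hi, appSec_add, ih]

lemma resSec_resSec (F : OModule X) {U V W : Opens X} (h : V ≤ U) (h' : W ≤ V) (s : Sec F U) :
    resSec F h' (resSec F h s) = resSec F (h'.trans h) s := by
  have := congr($(F.val.presheaf.map_comp (homOfLE h).op (homOfLE h').op) s)
  exact this.symm

lemma resFun_resFun {U V W : Opens X} (h : V ≤ U) (h' : W ≤ V) (s : Fun X U) :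
    resFun h' (resFun h s) = resFun (h'.trans h) s := by
  have := congr($((ringSheaf X).obj.map_comp (homOfLE h).op (homOfLE h').op) s)
  exact this.symm

lemma resFun_self {U : Opens X} (s : Fun X U) : resFun le_rfl s = s :=
  congr($((ringSheaf X).obj.map_id (op U)) s)

/-- Restriction of functions, as a ring homomorphism. -/
abbrev resFunHom {U V : Opens X} (h : V ≤ U) : Fun X U →+* Fun X V :=
  ((ringSheaf X).obj.map (homOfLE h).op).hom

lemma epi_iff_locally_surjective {F G : OModule X} (φ : F ⟶ G) :
    Epi φ ↔ ∀ (U : Opens X) (s : Sec G U), ∀ x ∈ U, ∃ (V : Opens X) (h : V ≤ U), x ∈ V ∧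
      ∃ t : Sec F V, appSec φ V t = resSec G h s := by
  constructor
  · intro _ U s x hx
    have := SheafOfModules.isLocallySurjective_of_epi φ
    obtain ⟨V, i, ⟨t, ht⟩, hxV⟩ :=
      Presheaf.imageSieve_mem (Opens.grothendieckTopology X)
        ((PresheafOfModules.toPresheaf _).map φ.val) (U := op U) s x hx
    exact ⟨V, leOfHom i, hxV, t, ht⟩
  · intro h
    have : Sheaf.IsLocallySurjective ((SheafOfModules.toSheaf _).map φ) := by
      constructor
      intro U s x hx
      obtain ⟨V, hVU, hxV, t, ht⟩ := h U s x hx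
      exact ⟨V, homOfLE hVU, ⟨t, ht⟩, hxV⟩
    have : Epi ((SheafOfModules.toSheaf _).map φ) := inferInstance
    exact (SheafOfModules.toSheaf _).epi_of_epi_map this

/-- Taking sections over a fixed open set is left exact. -/
lemma mem_range_kernel_ι {F G : OModule X} (φ : F ⟶ G) (U : Opens X) (s : Sec F U)
    (hs : appSec φ U s = 0) : ∃ t : Sec (kernel φ) U, appSec (kernel.ι φ) U t = s := by
  let ev := SheafOfModules.evaluation (ringSheaf X) (op U)
  have : ev.Additive := inferInstanceAs
    (SheafOfModules.forget _ ⋙ PresheafOfModules.evaluation _ (op U)).Additive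
  have h : ((ShortComplex.mk (kernel.ι φ) φ (kernel.condition φ)).map ev).Exact :=
    (ShortComplex.exact_kernel φ).map_of_mono_of_preservesKernel ev inferInstance inferInstance
  exact (ShortComplex.moduleCat_exact_iff _).1 h s hs

lemma kernel_ι_injective {F G : OModule X} (φ : F ⟶ G) (U : Opens X) :
    Function.Injective (appSec (kernel.ι φ) U) := by
  have : Mono (kernel.ι φ).val :=
    inferInstanceAs (Mono ((SheafOfModules.forget _).map (kernel.ι φ)))
  exact PresheafOfModules.injective_of_mono (kernel.ι φ).val (op U)

/-- A sequence of `𝒪_X`-modules is exact if and only if every section of the middle term which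
is mapped to zero comes locally from the left-hand term. -/
lemma exact_iff_locally (S : ShortComplex (OModule X)) :
    S.Exact ↔ ∀ (U : Opens X) (s : Sec S.X₂ U), appSec S.g U s = 0 → ∀ x ∈ U,
      ∃ (V : Opens X) (h : V ≤ U), x ∈ V ∧ ∃ t : Sec S.X₁ V, appSec S.f V t = resSec S.X₂ h s := by
  -- Kernels are computed on sections, so exactness reduces to local surjectivity onto the kernel.
  rw [S.exact_iff_epi_kernel_lift, epi_iff_locally_surjective]
  have hfac (V : Opens X) (t : Sec S.X₁ V) :
      appSec (kernel.ι S.g) V (appSec (kernel.lift S.g S.f S.zero) V t) = appSec S.f V t := by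
    rw [← appSec_comp, kernel.lift_ι]
  constructor
  · intro h U s hs x hx
    obtain ⟨s', rfl⟩ := mem_range_kernel_ι S.g U s hs
    obtain ⟨V, hVU, hxV, t, ht⟩ := h U s' x hx
    exact ⟨V, hVU, hxV, t, by rw [← hfac, ht, appSec_resSec]⟩
  · intro h U s x hx
    have h0 : appSec S.g U (appSec (kernel.ι S.g) U s) = 0 := by
      rw [← appSec_comp, kernel.condition, appSec_zero]
    obtain ⟨V, hVU, hxV, t, ht⟩ := h U (appSec (kernel.ι S.g) U s) h0 x hx
    refine ⟨V, hVU, hxV, t, kernel_ι_injective S.g V ?_⟩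
    exact (hfac V t).trans (ht.trans (appSec_resSec _ _ _).symm)

end RingedSpaceModules

/-! ### Linear systems over rings -/

/-- The row `b` is a linear form on A^I that vanishes on the image of `N`. By flatness it factors
through a map `a` from A^I to a finite free module that already kills this image. The coordinates of
`a` are solutions over A, hence combinations of rows of `M`. -/
lemma RingHom.Flat.exists_vecMul_eq {A B : Type*} [CommRing A] [CommRing B] {g : A →+* B}
    (hg : g.Flat) {I J K : Type*} [Fintype I] [Fintype J] [Fintype K]
    (M : Matrix J I A) (N : Matrix I K A) (h : ∀ v : I → A, v ᵥ* N = 0 → ∃ w, w ᵥ* M = v)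
    (b : I → B) (hb : b ᵥ* N.map g = 0) : ∃ c, c ᵥ* M.map g = b := by
  classical
  algebraize [g]
  have : Module.Flat A B := hg
  have hx : (Fintype.linearCombination A b) ∘ₗ N.mulVecLin = 0 := by
    ext k
    have := congrFun hb k
    simpa [Fintype.linearCombination_apply, vecMul, dotProduct, Algebra.smul_def, mul_comm,
      RingHom.algebraMap_toAlgebra] using this
  obtain ⟨l, a, y, hy, ha⟩ := Module.Flat.exists_factorization_of_comp_eq_zero_of_free hx
  have hker (r : Fin l) : (fun i => a (Pi.single i 1) r) ᵥ* N = 0 := by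
    ext k
    have := congr($ha (Pi.single k 1) r)
    rw [LinearMap.comp_apply, mulVecLin_apply, mulVec_single_one,
      pi_eq_sum_univ' (N.col k)] at this
    simpa [vecMul, dotProduct, mul_comm, Finsupp.finsetSum_apply] using this
  choose w hw using fun r => h _ (hker r)
  refine ⟨fun j => ∑ r, g (w r j) * y (Finsupp.single r 1), ?_⟩
  ext i
  have h1 : b i = y (a (Pi.single i 1)) := by
    have := congr($hy (Pi.single i 1))
    simpa [Fintype.linearCombination_apply, Pi.single_apply] using this
  have h2 : a (Pi.single i 1) = ∑ r, a (Pi.single i 1) r • Finsupp.single r (1 : A) := by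
    ext r
    simp
  rw [h1, h2, map_sum]
  have h3 (r : Fin l) : a (Pi.single i 1) r = ∑ j, w r j * M j i :=
    (congrFun (hw r) i).symm
  simp only [map_smul, h3, vecMul, dotProduct, Finset.sum_mul, Algebra.smul_def,
    RingHom.algebraMap_toAlgebra, map_sum, map_mul, Matrix.map_apply]
  rw [Finset.sum_comm]
  refine Finset.sum_congr rfl fun r _ => Finset.sum_congr rfl fun j _ => by ring

/-- Over a Noetherian ring, the solutions of a finite system of linear equations are generated
by the rows of a matrix. -/
lemma Matrix.exists_rows_span_ker {A : Type u} [CommRing A] [IsNoetherianRing A] {I K : Type u}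
    [Fintype I] [Fintype K] (N : Matrix I K A) :
    ∃ (J : Type u) (_ : Fintype J) (M : Matrix J I A), M * N = 0 ∧
      ∀ v : I → A, v ᵥ* N = 0 → ∃ w, w ᵥ* M = v := by
  obtain ⟨n, r, hr⟩ := Submodule.fg_iff_exists_fin_generating_family.1
    (IsNoetherian.noetherian (LinearMap.ker N.vecMulLinear))
  refine ⟨ULift (Fin n), inferInstance, Matrix.of fun j => r j.down, ?_, fun v hv => ?_⟩
  · ext j k
    have : r j.down ∈ LinearMap.ker N.vecMulLinear := hr ▸ Submodule.subset_span ⟨_, rfl⟩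
    exact congrFun this k
  · have : v ∈ Submodule.span A (Set.range r) := by rw [hr]; exact hv
    obtain ⟨c, rfl⟩ := (Submodule.mem_span_range_iff_exists_fun A).1 this
    refine ⟨fun j => c j.down, ?_⟩
    ext i
    simp only [vecMul, dotProduct, Matrix.of_apply, Finset.sum_apply, Pi.smul_apply, smul_eq_mul]
    exact Fintype.sum_equiv Equiv.ulift _ _ fun _ => rfl

lemma TopologicalSpace.Opens.exists_forall_of_antitone {X : Type*} [TopologicalSpace X]
    {ι : Type*} [Finite ι] {x : X} {U : Opens X} (hx : x ∈ U) {P : ι → (V : Opens X) → V ≤ U → Prop}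
    (hP : ∀ i (V W : Opens X) (hV : V ≤ U) (hW : W ≤ V), P i V hV → P i W (hW.trans hV))
    (h : ∀ i, ∃ (V : Opens X) (hV : V ≤ U), x ∈ V ∧ P i V hV) :
    ∃ (V : Opens X) (hV : V ≤ U), x ∈ V ∧ ∀ i, P i V hV := by
  have := Fintype.ofFinite ι
  choose V hV hxV hPV using h
  have hle (i) : U ⊓ Finset.univ.inf V ≤ V i := inf_le_right.trans (Finset.inf_le (Finset.mem_univ i))
  -- Intersecting with `U` matters for empty `ι`, where the infimum is the whole space.
  refine ⟨U ⊓ Finset.univ.inf V, inf_le_left, ⟨hx, ?_⟩, fun i => hP i _ _ (hV i) (hle i) (hPV i)⟩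
  rw [SetLike.mem_coe, ← SetLike.mem_coe, Opens.coe_finset_inf]
  simpa using hxV

/-! ### Free modules, coordinates and matrices -/

namespace RingedSpaceModules

variable {X : RingedSpace.{u, u}} {A : Type u} [CommRing A] (φ : A →+* Fun X ⊤)

/-- The map `A → 𝒪_X(U)` induced by a homomorphism from `A` to the global sections. -/
def toFun (U : Opens X) : A →+* Fun X U := (resFunHom le_top).comp φ

lemma resFun_toFun {U V : Opens X} (h : V ≤ U) (a : A) :
    resFun h (toFun φ U a) = toFun φ V a :=
  resFun_resFun le_top h (φ a)

/-- The unit `𝒪_X`-module. -/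
abbrev unit (X : RingedSpace.{u, u}) : OModule X := SheafOfModules.unit (ringSheaf X)

/-- The free `𝒪_X`-module. -/
abbrev free (X : RingedSpace.{u, u}) (I : Type u) : OModule X :=
  SheafOfModules.free (R := ringSheaf X) I

/-- The inclusion of a summand of a free module. -/
abbrev ιFree {I : Type u} (i : I) : unit X ⟶ free X I := SheafOfModules.ιFree i

/-- A function, viewed as a section of the unit `𝒪_X`-module. -/
def unitSec {U : Opens X} (a : Fun X U) : Sec (unit X) U := a

lemma unitSec_add {U : Opens X} (a b : Fun X U) : unitSec (a + b) = unitSec a + unitSec b := rfl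

lemma appSec_unitSec {F : OModule X} (ψ : unit X ⟶ F) (U : Opens X) (a : Fun X U) :
    appSec ψ U (unitSec a) = a • appSec ψ U (unitSec 1) := by
  have h := (appSec ψ U).map_smul a (unitSec 1)
  rwa [show a • unitSec 1 = unitSec a from mul_one a] at h

lemma unit_hom_ext {F : OModule X} {ψ χ : unit X ⟶ F}
    (h : ∀ U, appSec ψ U (unitSec 1) = appSec χ U (unitSec 1)) : ψ = χ := by
  apply F.unitHomEquiv.injective
  ext U
  exact h U.unop

/-- Multiplication by (the image of) `a : A` on `𝒪_X`. -/
def scalar (a : A) : unit X ⟶ unit X :=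
  (unit X).unitHomEquiv.symm
    (PresheafOfModules.sectionsMk (M := (unit X).val) (fun U => toFun φ U.unop a)
      (fun _ _ f => resFun_toFun φ (leOfHom f.unop) a))

lemma appSec_scalar_one (a : A) (U : Opens X) :
    appSec (scalar φ a) U (unitSec 1) = unitSec (toFun φ U a) := by
  have := (unit X).unitHomEquiv.apply_symm_apply
    (PresheafOfModules.sectionsMk (M := (unit X).val) (fun U => toFun φ U.unop a)
      (fun _ _ f => resFun_toFun φ (leOfHom f.unop) a))
  exact congr(($this).val (op U))

lemma appSec_scalar (a : A) (U : Opens X) (b : Fun X U) :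
    appSec (scalar φ a) U (unitSec b) = unitSec (b * toFun φ U a) := by
  rw [appSec_unitSec, appSec_scalar_one]
  rfl

lemma scalar_add (a b : A) : scalar φ (a + b) = scalar φ a + scalar φ b :=
  unit_hom_ext fun U => by
    rw [appSec_add, appSec_scalar_one, appSec_scalar_one, appSec_scalar_one, map_add, unitSec_add]

lemma scalar_zero : scalar φ 0 = 0 := by
  simpa using scalar_add φ 0 0

lemma scalar_sum {ι : Type*} (t : Finset ι) (a : ι → A) :
    scalar φ (∑ i ∈ t, a i) = ∑ i ∈ t, scalar φ (a i) :=
  map_sum (AddMonoidHom.mk' (scalar φ) (scalar_add φ)) a t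

lemma scalar_comp (a b : A) : scalar φ a ≫ scalar φ b = scalar φ (a * b) :=
  unit_hom_ext fun U => by
    rw [appSec_comp, appSec_scalar_one, appSec_scalar, appSec_scalar_one, map_mul]

/-- Morphisms from a free module are determined on the basis. -/
lemma free_hom_ext {I : Type u} {F : OModule X} {ψ χ : free X I ⟶ F}
    (h : ∀ i, ιFree i ≫ ψ = ιFree i ≫ χ) : ψ = χ :=
  Cofan.IsColimit.hom_ext (SheafOfModules.isColimitFreeCofan I) _ _ h

/-- The morphism from a free module with given restrictions to the summands. -/
def freeDesc {I : Type u} {F : OModule X} (ψ : I → (unit X ⟶ F)) : free X I ⟶ F :=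
  Cofan.IsColimit.desc (SheafOfModules.isColimitFreeCofan I) ψ

lemma ιFree_freeDesc {I : Type u} {F : OModule X} (ψ : I → (unit X ⟶ F)) (i : I) :
    ιFree i ≫ freeDesc ψ = ψ i :=
  Cofan.IsColimit.fac (SheafOfModules.isColimitFreeCofan I) ψ i

open Classical in
/-- The projection of a free module to a summand. -/
def πFree {I : Type u} (i : I) : free X I ⟶ unit X :=
  freeDesc fun j => if j = i then 𝟙 _ else 0

open Classical in
lemma ιFree_πFree {I : Type u} (i j : I) :
    ιFree i ≫ πFree (X := X) j = if i = j then 𝟙 _ else 0 :=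
  ιFree_freeDesc _ _

lemma sum_πFree_ιFree (I : Type u) [Fintype I] :
    ∑ i : I, πFree (X := X) i ≫ ιFree i = 𝟙 _ := by
  classical
  refine free_hom_ext fun j => ?_
  rw [Preadditive.comp_sum, Finset.sum_eq_single j]
  · rw [← Category.assoc, ιFree_πFree, if_pos rfl, Category.id_comp, Category.comp_id]
  · intro i _ hij
    rw [← Category.assoc, ιFree_πFree, if_neg hij.symm, zero_comp]
  · simp

/-- The coordinates of a section of a free module. -/
def coord {I : Type u} {U : Opens X} (s : Sec (free X I) U) (i : I) : Fun X U :=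
  appSec (πFree i) U s

/-- The section of a free module with given coordinates. -/
def ofCoord {I : Type u} [Fintype I] {U : Opens X} (c : I → Fun X U) : Sec (free X I) U :=
  ∑ i, appSec (ιFree i) U (unitSec (c i))

section

variable {I J K : Type u} {U V : Opens X}

lemma ofCoord_coord [Fintype I] (s : Sec (free X I) U) : ofCoord (coord s) = s := by
  have h := appSec_sum Finset.univ
    (fun i : I => πFree (X := X) i ≫ ιFree i) U s
  rw [sum_πFree_ιFree, appSec_id] at h
  exact h.symm

lemma coord_ofCoord [Fintype I] (c : I → Fun X U) : coord (ofCoord c) = c := by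
  classical
  ext i
  have h (j : I) : appSec (πFree (X := X) i) U (appSec (ιFree j) U (unitSec (c j))) =
      unitSec (if j = i then c j else 0) := by
    rw [← appSec_comp, ιFree_πFree]
    split_ifs <;> rfl
  rw [coord, ofCoord, map_sum, Finset.sum_congr rfl fun j _ => h j]
  exact (Finset.sum_ite_eq' Finset.univ i c).trans (if_pos (Finset.mem_univ i))

lemma coord_injective [Fintype I] : Function.Injective (coord (X := X) (I := I) (U := U)) :=
  fun s t h => by rw [← ofCoord_coord s, h, ofCoord_coord]

lemma coord_resSec (h : V ≤ U) (s : Sec (free X I) U) (i : I) :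
    coord (resSec _ h s) i = resFun h (coord s i) :=
  appSec_resSec (πFree i) h s

/-- The morphism of free modules defined by a matrix with coefficients in `A`; on coordinates
it is right multiplication by the matrix. -/
def mat [Fintype I] (M : Matrix J I A) : free X J ⟶ free X I :=
  freeDesc fun j => ∑ i, scalar φ (M j i) ≫ ιFree i

lemma ιFree_mat [Fintype I] (M : Matrix J I A) (j : J) :
    ιFree j ≫ mat φ M = ∑ i, scalar φ (M j i) ≫ ιFree i :=
  ιFree_freeDesc _ _

/-- With row vectors, diagrammatic composition is the matrix product, without transposition. -/
lemma mat_comp [Fintype I] [Fintype K] (M : Matrix J I A) (N : Matrix I K A) :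
    mat φ M ≫ mat φ N = mat φ (M * N) := by
  refine free_hom_ext fun j => ?_
  rw [← Category.assoc, ιFree_mat, ιFree_mat, Preadditive.sum_comp]
  simp only [Category.assoc, ιFree_mat, Preadditive.comp_sum]
  rw [Finset.sum_comm]
  refine Finset.sum_congr rfl fun k _ => ?_
  simp only [← Category.assoc, scalar_comp]
  rw [← Preadditive.sum_comp, ← scalar_sum]
  rfl

lemma mat_zero [Fintype I] : mat (X := X) φ (0 : Matrix J I A) = 0 :=
  free_hom_ext fun j => by simp [ιFree_mat, scalar_zero]

lemma mat_πFree [Fintype I] [Fintype J] (M : Matrix J I A) (i : I) :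
    mat (X := X) φ M ≫ πFree i = ∑ j, πFree j ≫ scalar φ (M j i) := by
  classical
  refine free_hom_ext fun j => ?_
  rw [← Category.assoc, ιFree_mat, Preadditive.sum_comp, Preadditive.comp_sum,
    Finset.sum_eq_single i, Finset.sum_eq_single j]
  · rw [Category.assoc, ιFree_πFree, if_pos rfl, ← Category.assoc, ιFree_πFree, if_pos rfl,
      Category.id_comp, Category.comp_id]
  · intro k _ hk
    rw [← Category.assoc, ιFree_πFree, if_neg hk.symm, zero_comp]
  · simp
  · intro k _ hk
    rw [Category.assoc, ιFree_πFree, if_neg hk, comp_zero]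
  · simp

lemma coord_mat [Fintype I] [Fintype J] (M : Matrix J I A) (s : Sec (free X J) U) :
    coord (appSec (mat φ M) U s) = coord s ᵥ* M.map (toFun φ U) := by
  ext i
  rw [coord, ← appSec_comp, mat_πFree, appSec_sum]
  exact Finset.sum_congr rfl fun j _ => appSec_scalar φ _ U _

end

/-! ### Local solvability from flat stalks -/

/-- All stalks of `𝒪_X` are flat over `A`. -/
def StalksFlat : Prop :=
  ∀ x : X, ((X.presheaf.germ ⊤ x trivial).hom.comp
    (show A →+* X.presheaf.obj (op ⊤) from φ)).Flat

variable {φ}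

/-- Linear systems over `A` whose solutions are generated by the rows of a matrix keep this
property locally on `X` when the stalks are flat over `A`. -/
lemma StalksFlat.exists_vecMul_eq (hφ : StalksFlat φ) {I J K : Type u} [Fintype I] [Fintype J]
    [Fintype K] (M : Matrix J I A) (N : Matrix I K A)
    (h : ∀ v : I → A, v ᵥ* N = 0 → ∃ w, w ᵥ* M = v) {U : Opens X} (s : I → Fun X U)
    (hs : s ᵥ* N.map (toFun φ U) = 0) {x : X} (hx : x ∈ U) :
    ∃ (V : Opens X) (hV : V ≤ U), x ∈ V ∧
      ∃ t : J → Fun X V, t ᵥ* M.map (toFun φ V) = fun i => resFun hV (s i) := by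
  let g := (X.presheaf.germ ⊤ x trivial).hom.comp (show A →+* X.presheaf.obj (op ⊤) from φ)
  let γ (V : Opens X) (hV : x ∈ V) : Fun X V →+* X.presheaf.stalk x :=
    (X.presheaf.germ V x hV).hom
  have hγ {V W : Opens X} (hWV : W ≤ V) (hW : x ∈ W) (a : Fun X V) :
      γ W hW (resFun hWV a) = γ V (hWV hW) a :=
    X.presheaf.germ_res_apply (homOfLE hWV) x hW a
  have hγg (V : Opens X) (hV : x ∈ V) (a : A) : γ V hV (toFun φ V a) = g a :=
    hγ le_top hV (φ a)
  have hγM (V : Opens X) (hV : x ∈ V) {I J : Type u} (M : Matrix I J A) :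
      (M.map (toFun φ V)).map (γ V hV) = M.map g := by
    ext i j
    exact hγg V hV _
  -- Flatness solves the system in the stalk at `x`; what follows spreads the solution to a
  -- neighbourhood.
  obtain ⟨c, hc⟩ := (hφ x).exists_vecMul_eq M N h (fun i => γ U hx (s i)) (by
    have h1 := congr(γ U hx ∘ $hs)
    rw [← hγM U hx]
    ext k
    exact (RingHom.map_vecMul (γ U hx) _ _ k).symm.trans ((congrFun h1 k).trans (map_zero _)))
  obtain ⟨V, hVU, hxV, ht⟩ := Opens.exists_forall_of_antitone hx
    (P := fun j V _ => ∀ hV : x ∈ V, ∃ t : Fun X V, γ V hV t = c j)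
    (fun j V W hV hWV ht hW => by
      obtain ⟨t, ht⟩ := ht (hWV hW)
      exact ⟨resFun hWV t, by rw [hγ, ht]⟩)
    (fun j => by
      obtain ⟨V, hxV, t, ht⟩ := X.presheaf.exists_germ_eq (c j)
      refine ⟨U ⊓ V, inf_le_left, ⟨hx, hxV⟩, fun _ => ⟨resFun inf_le_right t, ?_⟩⟩
      exact (hγ inf_le_right ⟨hx, hxV⟩ t).trans ht)
  choose t ht using fun j => ht j hxV
  -- The finitely many equations hold for germs at `x`, hence on a smaller neighbourhood.
  obtain ⟨W, hWV, hxW, hW⟩ := Opens.exists_forall_of_antitone hxV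
    (P := fun i W (hW : W ≤ V) => resFun hW ((t ᵥ* M.map (toFun φ V)) i) =
      resFun (hW.trans hVU) (s i))
    (fun i W W' hW hW' hh => by
      rw [← resFun_resFun hW hW', hh, resFun_resFun])
    (fun i => by
      have : γ V hxV ((t ᵥ* M.map (toFun φ V)) i) = γ V hxV (resFun hVU (s i)) := by
        rw [RingHom.map_vecMul, hγM, hγ, show γ V hxV ∘ t = c from funext ht, hc]
      obtain ⟨W, hxW, i₁, i₂, h⟩ := X.presheaf.germ_eq x hxV hxV _ _ this
      refine ⟨W, leOfHom i₁, hxW, Eq.trans h ?_⟩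
      exact resFun_resFun hVU (leOfHom i₂) (s i))
  refine ⟨W, hWV.trans hVU, hxW, fun j => resFun hWV (t j), funext fun i => ?_⟩
  rw [← hW i]
  change _ = resFunHom hWV _
  rw [RingHom.map_vecMul]
  congr 1
  ext a b
  exact (resFun_toFun φ hWV _).symm

/-- An exact pair of matrices over `A` induces an exact sequence of free `𝒪_X`-modules if
the stalks of `𝒪_X` are flat over `A`. -/
lemma StalksFlat.exact_mat (hφ : StalksFlat φ) {I J K : Type u} [Fintype I] [Fintype J]
    [Fintype K] (M : Matrix J I A) (N : Matrix I K A) (hMN : M * N = 0)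
    (h : ∀ v : I → A, v ᵥ* N = 0 → ∃ w, w ᵥ* M = v) :
    (ShortComplex.mk (mat (X := X) φ M) (mat φ N)
      (by rw [mat_comp, hMN, mat_zero])).Exact := by
  rw [exact_iff_locally]
  intro U s hs x hx
  obtain ⟨V, hVU, hxV, t, ht⟩ := hφ.exists_vecMul_eq M N h (coord s)
    (by rw [← coord_mat]; erw [hs]; funext i; exact map_zero (appSec (πFree i) U)) hx
  refine ⟨V, hVU, hxV, ofCoord t, coord_injective ?_⟩
  funext i
  rw [coord_mat, coord_ofCoord, ht]
  exact (coord_resSec hVU s i).symm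

end RingedSpaceModules

/-! ### Vanishing of H¹ and exactness of global sections -/

namespace CategoryTheory

universe w v

/-- If `0 ⟶ G ⟶ M ⟶ N ⟶ P` is exact and `Ext¹(Z, G) = 0`, then `Hom(Z, -)` is exact at `N`. -/
lemma exists_comp_eq_of_subsingleton_ext {C : Type w} [Category.{v} C] [Abelian C]
    [HasExt.{u} C] {Z G M N P : C} {i : G ⟶ M} {f : M ⟶ N} {g : N ⟶ P} {hif : i ≫ f = 0}
    {hfg : f ≫ g = 0} [Mono i] (hi : (ShortComplex.mk i f hif).Exact)
    (hf : (ShortComplex.mk f g hfg).Exact) [Subsingleton (Abelian.Ext Z G 1)] (b : Z ⟶ N)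
    (hb : b ≫ g = 0) : ∃ c : Z ⟶ M, c ≫ f = b := by
  have hf' := (ShortComplex.exact_iff_exact_image_ι _).1 hf
  -- The image of `f` is the quotient of `M` by `G`, so lifting `b'` to `M` is obstructed only by a
  -- class in Ext¹(Z, G).
  let b' : Z ⟶ Abelian.image f := hf'.lift b hb
  have hb' : b' ≫ Abelian.image.ι f = b := hf'.lift_f b hb
  have h₀ : i ≫ Abelian.factorThruImage f = 0 := by
    rw [← cancel_mono (Abelian.image.ι f), Category.assoc, Abelian.image.fac, hif, zero_comp]
  have hS : (ShortComplex.mk i (Abelian.factorThruImage f) h₀).ShortExact :=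
    { exact := by
        let α : ShortComplex.mk i (Abelian.factorThruImage f) h₀ ⟶ ShortComplex.mk i f hif :=
          { τ₁ := 𝟙 _, τ₂ := 𝟙 _, τ₃ := Abelian.image.ι f }
        have : Mono α.τ₃ := inferInstanceAs (Mono (Abelian.image.ι f))
        exact (ShortComplex.exact_iff_of_epi_of_isIso_of_mono α).2 hi
      mono_f := inferInstance
      epi_g := inferInstance }
  obtain ⟨x, hx⟩ := Abelian.Ext.covariant_sequence_exact₃ Z hS (Abelian.Ext.mk₀ b') (zero_add 1)
    (Subsingleton.elim _ _)
  obtain ⟨c, rfl⟩ := (Abelian.Ext.mk₀_bijective _ _).2 x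
  refine ⟨c, ?_⟩
  rw [Abelian.Ext.mk₀_comp_mk₀] at hx
  have h : c ≫ Abelian.factorThruImage f = b' := (Abelian.Ext.mk₀_bijective _ _).1 hx
  rw [← hb', ← h, Category.assoc, Abelian.image.fac]

/-- If `0 ⟶ G ⟶ M ⟶ N ⟶ P` is an exact sequence of abelian sheaves and `H¹(G) = 0`, then
taking global sections is exact at `N`. -/
lemma Sheaf.exists_section_of_subsingleton_H {C : Type u} [Category.{u} C]
    {J : GrothendieckTopology C} [HasSheafify J AddCommGrpCat.{u}]
    [HasExt.{u} (Sheaf J AddCommGrpCat.{u})] {T : C} (hT : IsTerminal T)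
    {G M N P : Sheaf J AddCommGrpCat.{u}} {i : G ⟶ M} {f : M ⟶ N} {g : N ⟶ P}
    {hif : i ≫ f = 0} {hfg : f ≫ g = 0} [Mono i] (hi : (ShortComplex.mk i f hif).Exact)
    (hf : (ShortComplex.mk f g hfg).Exact) [Subsingleton (Sheaf.H.{u} G 1)]
    (s : N.obj.obj (op T)) (hs : g.hom.app (op T) s = 0) :
    ∃ t : M.obj.obj (op T), f.hom.app (op T) t = s := by
  -- A section over the terminal object is a degree-zero class, that is, a morphism from the
  -- constant sheaf whose Ext groups define cohomology.
  obtain ⟨x, rfl⟩ := (H.equiv₀ N hT).surjective s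
  have hx : Abelian.Ext.addEquiv₀ x ≫ g = 0 := by
    rw [← H.addEquiv₀_map, EmbeddingLike.map_eq_zero_iff]
    rwa [H.equiv₀_naturality, EmbeddingLike.map_eq_zero_iff] at hs
  obtain ⟨c, hc⟩ := exists_comp_eq_of_subsingleton_ext hi hf (Abelian.Ext.addEquiv₀ x) hx
  refine ⟨H.equiv₀ M hT (Abelian.Ext.addEquiv₀.symm c), ?_⟩
  rw [H.equiv₀_naturality]
  congr 1
  apply Abelian.Ext.addEquiv₀.injective
  rw [H.addEquiv₀_map, AddEquiv.apply_symm_apply, hc]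

end CategoryTheory

namespace RingedSpaceModules

/-! ### Inverse images of free modules and of matrices -/

section Pullback

variable {X Y : RingedSpace.{u, u}} (f : X ⟶ Y) {A : Type u} [CommRing A]

/-- The homomorphism to the global sections of `X` induced by one to those of `Y`. -/
def pullbackHom (φ : A →+* Fun Y ⊤) : A →+* Fun X ⊤ :=
  ((comorphism f).hom.app (op ⊤)).hom.comp φ

variable (φ : A →+* Fun Y ⊤)

lemma comorphism_toFun (U : Opens Y) (a : A) :
    (comorphism f).hom.app (op U) (toFun φ U a) =
      toFun (pullbackHom f φ) ((Opens.map f.hom.base).obj U) a :=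
  congr($((comorphism f).hom.naturality (homOfLE (le_top (a := U))).op) (φ a))

/-- The inverse image functor is left adjoint to the direct image functor. -/
def pullbackPushforwardAdjunction : pullback f ⊣ pushforward f :=
  SheafOfModules.pullbackPushforwardAdjunction.{u} (comorphism f)

instance : (pullback f).IsLeftAdjoint := (pullbackPushforwardAdjunction f).isLeftAdjoint

instance : (pushforward f).Additive where

instance : (pullback f).Additive := (pullbackPushforwardAdjunction f).left_adjoint_additive

/-- The map `𝒪_Y ⟶ f_* 𝒪_X` of `𝒪_Y`-modules. -/
def unitToPushforward : unit Y ⟶ (pushforward f).obj (unit X) :=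
  SheafOfModules.unitToPushforwardObjUnit (comorphism f)

/-- The canonical map `f^* 𝒪_Y ⟶ 𝒪_X`. -/
def pullbackUnit : (pullback f).obj (unit Y) ⟶ unit X :=
  ((pullbackPushforwardAdjunction f).homEquiv _ _).symm (unitToPushforward f)

/-- Under the adjunction both sides become maps out of 𝒪_Y, and both send 1 to the image of `a`. -/
lemma pullback_map_scalar (a : A) :
    (pullback f).map (scalar φ a) ≫ pullbackUnit f =
      pullbackUnit f ≫ scalar (pullbackHom f φ) a := by
  apply ((pullbackPushforwardAdjunction f).homEquiv _ _).injective
  rw [Adjunction.homEquiv_naturality_left, Adjunction.homEquiv_naturality_right, pullbackUnit,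
    Equiv.apply_symm_apply]
  refine unit_hom_ext fun U => ?_
  have h1 : appSec (unitToPushforward f) U (unitSec 1) =
      unitSec (U := (Opens.map f.hom.base).obj U) 1 :=
    map_one ((comorphism f).hom.app (op U)).hom
  rw [appSec_comp, appSec_comp, appSec_scalar_one, h1]
  refine (comorphism_toFun f φ U a).trans ?_
  exact (appSec_scalar_one (pullbackHom f φ) a _).symm

/-- The pullback of a free module is free. -/
def pullbackFree (I : Type u) : (pullback f).obj (free Y I) ≅ free X I :=
  SheafOfModules.pullbackObjFreeIso (comorphism f) I

lemma pullback_map_ιFree {I : Type u} (i : I) :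
    (pullback f).map (ιFree i) ≫ (pullbackFree f I).hom =
      pullbackUnit f ≫ ιFree i :=
  SheafOfModules.pullback_map_ιFree_comp_pullbackObjFreeIso_hom (comorphism f) i

lemma pullback_free_hom_ext {I : Type u} {F : OModule X}
    {α β : (pullback f).obj (free Y I) ⟶ F}
    (h : ∀ i, (pullback f).map (ιFree i) ≫ α = (pullback f).map (ιFree i) ≫ β) : α = β :=
  Cofan.IsColimit.hom_ext (isColimitCofanMkObjOfIsColimit (pullback f) _ _
    (SheafOfModules.isColimitFreeCofan (R := ringSheaf Y) I)) _ _ h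

lemma pullback_map_mat {I J : Type u} [Fintype I] (M : Matrix J I A) :
    (pullback f).map (mat φ M) ≫ (pullbackFree f I).hom =
      (pullbackFree f J).hom ≫ mat (pullbackHom f φ) M := by
  refine pullback_free_hom_ext f fun j => ?_
  rw [← Category.assoc, ← Functor.map_comp, ιFree_mat, Functor.map_sum, Preadditive.sum_comp,
    ← Category.assoc, pullback_map_ιFree]
  rw [Category.assoc, ιFree_mat, Preadditive.comp_sum]
  refine Finset.sum_congr rfl fun i _ => ?_
  rw [Functor.map_comp, Category.assoc, pullback_map_ιFree, ← Category.assoc,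
    pullback_map_scalar, Category.assoc]

/-- The pullback of the cokernel of a matrix is the cokernel of the pulled back matrix. -/
lemma exists_presentation_pullback_cokernel {I J : Type u} [Fintype I] (M : Matrix J I A) :
    ∃ (p : free X I ⟶ (pullback f).obj (cokernel (mat φ M)))
      (h : mat (pullbackHom f φ) M ≫ p = 0), Epi p ∧ (ShortComplex.mk _ p h).Exact := by
  -- The inverse image is a left adjoint, so it preserves cokernels without any flatness.
  have hE := (ShortComplex.exact_cokernel (mat φ M)).map_of_epi_of_preservesCokernel
    (pullback f) inferInstance inferInstance
  have h : mat (pullbackHom f φ) M ≫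
      (pullbackFree f I).inv ≫ (pullback f).map (cokernel.π (mat φ M)) = 0 := by
    rw [← Category.assoc, ← cancel_epi (pullbackFree f J).hom, ← Category.assoc,
      ← Category.assoc, ← pullback_map_mat, Category.assoc, Category.assoc, Iso.hom_inv_id_assoc,
      ← Functor.map_comp, cokernel.condition, Functor.map_zero, comp_zero]
  refine ⟨(pullbackFree f I).inv ≫ (pullback f).map (cokernel.π (mat φ M)), h, inferInstance, ?_⟩
  refine (ShortComplex.exact_iff_of_iso (ShortComplex.isoMk
    (S₁ := (ShortComplex.mk _ _ (cokernel.condition (mat φ M))).map (pullback f))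
    (S₂ := ShortComplex.mk _ _ h)
    (pullbackFree f J) (pullbackFree f I) (Iso.refl _) ?_ ?_)).1 hE
  · exact (pullback_map_mat f φ M).symm
  · exact (Iso.hom_inv_id_assoc _ _).trans (Category.comp_id _).symm

end Pullback

/-! ### The syzygy argument on global sections -/

variable {X : RingedSpace.{u, u}} {A : Type u} [CommRing A] {φ : A →+* Fun X ⊤}

/-- Global solvability of linear systems from the vanishing of the cohomology of a syzygy. -/
lemma StalksFlat.exists_global_vecMul_eq (hφ : StalksFlat φ) {I₀ I₁ I₂ I₃ I₄ : Type u}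
    [Fintype I₀] [Fintype I₁] [Fintype I₂] [Fintype I₃] [Fintype I₄]
    {M : Matrix I₁ I₀ A} {N : Matrix I₂ I₁ A} {P : Matrix I₃ I₂ A} {Q : Matrix I₄ I₃ A}
    (hNM : N * M = 0) (hPN : P * N = 0) (hQP : Q * P = 0)
    (hM : ∀ v, v ᵥ* M = 0 → ∃ w, w ᵥ* N = v) (hN : ∀ v, v ᵥ* N = 0 → ∃ w, w ᵥ* P = v)
    (hP : ∀ v, v ᵥ* P = 0 → ∃ w, w ᵥ* Q = v) {G : OModule X} {p : free X I₃ ⟶ G} [Epi p]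
    {hp : mat φ Q ≫ p = 0} (hE : (ShortComplex.mk _ p hp).Exact)
    [Subsingleton (Cohomology G 1)] (s : I₁ → Fun X ⊤) (hs : s ᵥ* M.map (toFun φ ⊤) = 0) :
    ∃ t : I₂ → Fun X ⊤, t ᵥ* N.map (toFun φ ⊤) = s := by
  have e₁ := hφ.exact_mat N M hNM hM
  have e₂ := hφ.exact_mat P N hPN hN
  have e₃ := hφ.exact_mat Q P hQP hP
  have hQP' : mat (X := X) φ Q ≫ mat φ P = 0 := by rw [mat_comp, hQP, mat_zero]
  have hPN' : mat (X := X) φ P ≫ mat φ N = 0 := by rw [mat_comp, hPN, mat_zero]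
  have hNM' : mat (X := X) φ N ≫ mat φ M = 0 := by rw [mat_comp, hNM, mat_zero]
  -- `G` is the cokernel of `Q`, so `P` descends to it; exactness at `I₃` makes the descended map a
  -- monomorphism, and `G` becomes the kernel of `N`.
  let i : G ⟶ free X I₂ := hE.desc (mat φ P) hQP'
  have hi : p ≫ i = mat φ P := hE.g_desc (mat φ P) hQP'
  have hiN : i ≫ mat φ N = 0 := by rw [← cancel_epi p, ← Category.assoc, hi, hPN', comp_zero]
  have : Mono i := by
    rw [Preadditive.mono_iff_cancel_zero]
    intro Z z hz
    obtain ⟨Z', π, _, x, hx⟩ := surjective_up_to_refinements_of_epi p z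
    have hx0 : x ≫ mat φ P = 0 := by
      rw [← hi, ← Category.assoc, ← hx, Category.assoc, hz, comp_zero]
    obtain ⟨Z'', π', _, y, hy⟩ := e₃.exact_up_to_refinements x hx0
    rw [← cancel_epi π, ← cancel_epi π', hx, ← Category.assoc, hy, Category.assoc]
    dsimp only
    rw [hp, comp_zero, comp_zero, comp_zero]
  have e₂' : (ShortComplex.mk i (mat φ N) hiN).Exact :=
    let α : ShortComplex.mk (mat φ P) (mat φ N) hPN' ⟶ ShortComplex.mk i (mat φ N) hiN :=
      { τ₁ := p, τ₂ := 𝟙 _, τ₃ := 𝟙 _, comm₁₂ := by simpa using hi }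
    have : Epi α.τ₁ := inferInstanceAs (Epi p)
    (ShortComplex.exact_iff_of_epi_of_isIso_of_mono α).1 e₂
  let Φ := SheafOfModules.toSheaf (ringSheaf X)
  have hs' : appSec (mat φ M) ⊤ (ofCoord s) = 0 := by
    refine coord_injective ?_
    rw [coord_mat, coord_ofCoord, hs]
    funext i
    exact (map_zero (appSec (πFree i) ⊤)).symm
  obtain ⟨(t : Sec (free X I₂) ⊤), ht⟩ := Sheaf.exists_section_of_subsingleton_H
    (T := (⊤ : Opens X)) isTerminalTop (e₂'.map Φ) (e₁.map Φ) (ofCoord s) hs'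
  refine ⟨coord t, ?_⟩
  rw [← coord_mat]
  exact (congrArg coord ht).trans (coord_ofCoord s)

end RingedSpaceModules

/-! ### Coherence of cokernels of matrices -/

namespace RingedSpaceModules

variable {X : RingedSpace.{u, u}} {A : Type u} [CommRing A]

lemma Fun.mul_comm {U : Opens X} (a b : Fun X U) : a * b = b * a :=
  _root_.mul_comm (G := X.presheaf.obj (op U)) a b

lemma resFun_one {U V : Opens X} (h : V ≤ U) : resFun h (1 : Fun X U) = 1 :=
  map_one (resFunHom h)

lemma resFun_mul {U V : Opens X} (h : V ≤ U) (a b : Fun X U) :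
    resFun h (a * b) = resFun h a * resFun h b :=
  map_mul (resFunHom h) a b

section Free

variable {I : Type u} {F : OModule X} (p : free X I ⟶ F)

/-- The sections of `F` which are the images of the basis of a free module. -/
def gen (i : I) (U : Opens X) : Sec F U := appSec (ιFree i ≫ p) U (unitSec 1)

lemma resSec_gen (i : I) {U V : Opens X} (h : V ≤ U) : resSec F h (gen p i U) = gen p i V := by
  rw [gen, ← appSec_resSec]
  congr 1
  exact resFun_one h

lemma appSec_ofCoord [Fintype I] {U : Opens X} (c : I → Fun X U) :
    appSec p U (ofCoord c) = ∑ i, c i • gen p i U := by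
  rw [ofCoord, map_sum]
  exact Finset.sum_congr rfl fun i _ => appSec_unitSec (ιFree i ≫ p) U (c i)

lemma isFiniteType_of_epi [Finite I] [Epi p] : IsFiniteType F := by
  have := Fintype.ofFinite I
  let e := Fintype.equivFin I
  refine fun x => ⟨⊤, trivial, Fintype.card I, fun i => gen p (e.symm i) ⊤,
    fun V hV t y hy => ?_⟩
  obtain ⟨W, hWV, hyW, t', ht'⟩ := (epi_iff_locally_surjective p).1 inferInstance V t y hy
  refine ⟨W, hWV, hyW, ?_⟩
  rw [← ht', ← ofCoord_coord t', appSec_ofCoord]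
  refine Submodule.sum_mem _ fun i _ => Submodule.smul_mem _ _ (Submodule.subset_span ⟨e i, ?_⟩)
  exact (resSec_gen p _ _).trans (by rw [Equiv.symm_apply_apply])

end Free

/-- Every section of `𝒪_X` is locally a fraction of elements of `A`. -/
def LocallyFraction (φ : A →+* Fun X ⊤) : Prop :=
  ∀ (U : Opens X) (a : Fun X U), ∀ x ∈ U, ∃ (V : Opens X) (h : V ≤ U), x ∈ V ∧
    ∃ d n : A, IsUnit (toFun φ V d) ∧ resFun h a * toFun φ V d = toFun φ V n

lemma isUnit_toFun {φ : A →+* Fun X ⊤} {U V : Opens X} (h : V ≤ U) {d : A}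
    (hd : IsUnit (toFun φ U d)) : IsUnit (toFun φ V d) := by
  rw [← resFun_toFun φ h]
  exact hd.map (resFunHom h)

/-- Finitely many sections of `𝒪_X` have locally a common denominator. -/
lemma LocallyFraction.exists_common {φ : A →+* Fun X ⊤} (hφ : LocallyFraction φ) {ι : Type*}
    [Fintype ι] {U : Opens X} (a : ι → Fun X U) {x : X} (hx : x ∈ U) :
    ∃ (V : Opens X) (h : V ≤ U), x ∈ V ∧ ∃ (d : A) (n : ι → A), IsUnit (toFun φ V d) ∧
      ∀ i, resFun h (a i) * toFun φ V d = toFun φ V (n i) := by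
  classical
  obtain ⟨V, hV, hxV, h⟩ := Opens.exists_forall_of_antitone hx
    (P := fun i V h => ∃ d n : A, IsUnit (toFun φ V d) ∧
      resFun h (a i) * toFun φ V d = toFun φ V n)
    (fun i V W hV hW ⟨d, n, hd, hn⟩ => ⟨d, n, isUnit_toFun hW hd, by
      rw [← resFun_resFun hV hW, ← resFun_toFun φ hW, ← resFun_mul, hn, resFun_toFun]⟩)
    (fun i => hφ U (a i) x hx)
  choose d n hd hn using h
  -- The common denominator is the product; each numerator picks up the other denominators.
  refine ⟨V, hV, hxV, ∏ i, d i, fun i => n i * ∏ j ∈ Finset.univ.erase i, d j, ?_, fun i => ?_⟩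
  · exact Finset.prod_induction d (fun b => IsUnit (toFun φ V b))
      (fun b c hb hc => by rw [map_mul]; exact hb.mul hc) (by rw [map_one]; exact isUnit_one)
      fun i _ => hd i
  · rw [← Finset.mul_prod_erase _ _ (Finset.mem_univ i), map_mul, ← mul_assoc, hn, map_mul]

variable {φ : A →+* Fun X ⊤}

/-- The relations between sections of the cokernel of a matrix over `A` which come from
vectors over `A` are solutions of a linear system over `A`, up to a denominator. -/
lemma exists_linear_system (hφ' : LocallyFraction φ) {I : Type u} [Fintype I] {F : OModule X}
    (p : free X I ⟶ F) [Epi p] {n : ℕ} {U : Opens X} (s : Fin n → Sec F U) {x : X} (hx : x ∈ U) :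
    ∃ (V : Opens X) (hV : V ≤ U), x ∈ V ∧ ∃ B : Matrix (Fin n) I A,
      ∀ (W : Opens X) (hW : W ≤ V) (a : Fin n → Fun X W),
        ∑ i, a i • resSec F (hW.trans hV) (s i) = 0 ↔
          appSec p W (ofCoord (a ᵥ* B.map (toFun φ W))) = 0 := by
  obtain ⟨V₁, hV₁, hxV₁, h₁⟩ := Opens.exists_forall_of_antitone hx
    (P := fun i V h => ∃ t : Sec (free X I) V, appSec p V t = resSec F h (s i))
    (fun i V W hV hW ⟨t, ht⟩ => ⟨resSec _ hW t, by rw [appSec_resSec, ht, resSec_resSec]⟩)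
    (fun i => (epi_iff_locally_surjective p).1 inferInstance U (s i) x hx)
  choose t ht using h₁
  -- Clear all denominators in the coordinates of the lifts at once. As `d` is invertible on `V`,
  -- multiplying by it does not change the relations.
  obtain ⟨V, hV, hxV, d, b, hd, hb⟩ :=
    hφ'.exists_common (fun ik : Fin n × I => coord (t ik.1) ik.2) hxV₁
  refine ⟨V, hV.trans hV₁, hxV, Matrix.of fun i k => b (i, k), fun W hW a => ?_⟩
  have hs (i : Fin n) : toFun φ W d • resSec F (hW.trans (hV.trans hV₁)) (s i) =
      ∑ k, toFun φ W (b (i, k)) • gen p k W := by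
    rw [← resSec_resSec F hV₁ (hW.trans hV), ← ht, ← appSec_resSec,
      ← ofCoord_coord (resSec _ _ (t i)), appSec_ofCoord, Finset.smul_sum]
    refine Finset.sum_congr rfl fun k _ => ?_
    rw [smul_smul, coord_resSec, Fun.mul_comm, ← resFun_resFun hV hW, ← resFun_toFun φ hW,
      ← resFun_mul, hb (i, k), resFun_toFun]
  have key : toFun φ W d • ∑ i, a i • resSec F (hW.trans (hV.trans hV₁)) (s i) =
      appSec p W (ofCoord (a ᵥ* (Matrix.of fun i k => b (i, k)).map (toFun φ W))) := by
    rw [appSec_ofCoord, Finset.smul_sum]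
    simp only [smul_smul, Fun.mul_comm (toFun φ W d)]
    simp only [← smul_smul, hs, Finset.smul_sum]
    rw [Finset.sum_comm]
    refine Finset.sum_congr rfl fun k _ => ?_
    rw [vecMul, dotProduct, Finset.sum_smul]
    exact Finset.sum_congr rfl fun i _ => smul_smul _ _ _
  rw [← key]
  exact ((isUnit_toFun hW hd).smul_eq_zero).symm

/-- After shrinking, `a` is a relation exactly when aB + cM = 0 for some `c` locally. This system
has coefficients in A, where finitely many rows generate its solutions; by flat stalks they generate
the solutions locally on X too. Their `a`-components generate the relations. -/
lemma StalksFlat.isCoherent_cokernel [IsNoetherianRing A] (hφ : StalksFlat φ)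
    (hφ' : LocallyFraction φ) {I J : Type u} [Fintype I] [Fintype J] (M : Matrix J I A) :
    IsCoherent (cokernel (mat (X := X) φ M)) := by
  set F := cokernel (mat (X := X) φ M)
  let p : free X I ⟶ F := cokernel.π _
  have hp : mat φ M ≫ p = 0 := cokernel.condition _
  have hE : (ShortComplex.mk _ p hp).Exact := ShortComplex.exact_cokernel _
  refine ⟨isFiniteType_of_epi p, fun U n s x hx => ?_⟩
  obtain ⟨V, hVU, hxV, B, hB⟩ := exists_linear_system hφ' p s hx
  let BM : Matrix (ULift.{u} (Fin n) ⊕ J) I A := Matrix.fromRows (B.submatrix ULift.down id) M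
  have hBM (W : Opens X) (a : Fin n → Fun X W) (c : J → Fun X W) :
      Sum.elim (fun i => a i.down) c ᵥ* BM.map (toFun φ W) =
        a ᵥ* B.map (toFun φ W) + c ᵥ* M.map (toFun φ W) := by
    ext k
    rw [Pi.add_apply]
    simp only [vecMul, dotProduct, Fintype.sum_sum_type]
    congr 1
    exact Fintype.sum_equiv Equiv.ulift _ _ fun _ => rfl
  obtain ⟨K, _, L, hL, hker⟩ := BM.exists_rows_span_ker
  let e := Fintype.equivFin K
  refine ⟨V, hVU, hxV, Fintype.card K, fun j i => toFun φ V (L (e.symm j) (Sum.inl ⟨i⟩)),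
    fun j => ?_, fun W hWV a ha y hy => ?_⟩
  · refine (hB V le_rfl _).2 ?_
    have h1 := hBM V (fun i => toFun φ V (L (e.symm j) (Sum.inl ⟨i⟩)))
      (fun i => toFun φ V (L (e.symm j) (Sum.inr i)))
    have h2 : Sum.elim (fun i : ULift (Fin n) => toFun φ V (L (e.symm j) (Sum.inl ⟨i.down⟩)))
        (fun i => toFun φ V (L (e.symm j) (Sum.inr i))) ᵥ* BM.map (toFun φ V) = 0 := by
      have h3 : Sum.elim (fun i : ULift (Fin n) => toFun φ V (L (e.symm j) (Sum.inl ⟨i.down⟩)))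
        (fun i => toFun φ V (L (e.symm j) (Sum.inr i))) = toFun φ V ∘ L (e.symm j) := by
        ext (i | i) <;> rfl
      ext k
      rw [h3, ← RingHom.map_vecMul]
      exact (congrArg (toFun φ V) (congrFun (congrFun hL (e.symm j)) k)).trans (map_zero _)
    rw [h2] at h1
    -- Here aB = -cM, so it lies in the image of `M` and is killed by `p`.
    rw [eq_neg_of_add_eq_zero_left h1.symm, ← neg_vecMul, ← coord_ofCoord (-fun i => _),
      ← coord_mat, ofCoord_coord, ← appSec_comp, hp, appSec_zero]
  · have ha' := (hB W hWV a).1 ha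
    obtain ⟨W₁, hW₁, hyW₁, c, hc⟩ := (exact_iff_locally _).1 hE W _ ha' y hy
    have h1 : Sum.elim (fun i : ULift (Fin n) => resFun hW₁ (a i.down)) (-coord c) ᵥ*
        BM.map (toFun φ W₁) = 0 := by
      rw [hBM W₁ (fun i => resFun hW₁ (a i)), neg_vecMul, ← coord_mat, add_neg_eq_zero]
      refine Eq.trans ?_ (congrArg coord hc).symm
      ext k
      rw [coord_resSec, coord_ofCoord]
      refine Eq.trans ?_ (RingHom.map_vecMul (resFunHom hW₁) _ _ k).symm
      congr 1
      ext i k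
      exact (resFun_toFun φ hW₁ _).symm
    obtain ⟨W', hW', hyW', w, hw⟩ := hφ.exists_vecMul_eq L BM hker _ h1 hyW₁
    refine ⟨W', hW'.trans hW₁, hyW', ?_⟩
    have h2 : (fun i => resFun (hW'.trans hW₁) (a i)) =
        ∑ j, w j • fun i : Fin n => toFun φ W' (L j (Sum.inl ⟨i⟩)) := by
      ext i
      rw [← resFun_resFun hW₁ hW']
      refine (congrFun hw (Sum.inl ⟨i⟩)).symm.trans ?_
      rw [Finset.sum_apply]
      rfl
    rw [h2]
    refine Submodule.sum_mem _ fun j _ => Submodule.smul_mem _ _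
      (Submodule.subset_span ⟨e j, ?_⟩)
    ext i
    exact (resFun_toFun φ _ _).trans (by rw [Equiv.symm_apply_apply])

lemma isQuasiCoherent_cokernel {I J : Type u} [Fintype I] (M : Matrix J I A) :
    IsQuasiCoherent (cokernel (mat (X := X) φ M)) :=
  (SheafOfModules.presentationOfIsCokernelFree (mat φ M) (cokernel.π _)
    (cokernel.condition _) (cokernelIsCokernel _)).isQuasicoherent

end RingedSpaceModules

/-! ### The structure sheaf of Spec A -/

namespace RingedSpaceModules

/-- The canonical map `A → Γ(Spec A, 𝒪)`. -/
def specHom (A : Type u) [CommRing A] : A →+* Fun (SpecRingedSpace A) ⊤ :=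
  (Scheme.ΓSpecIso (CommRingCat.of A)).inv.hom

section Spec

variable {A : Type u} [CommRing A]

lemma germ_specHom (x : PrimeSpectrum A) (a : A) :
    (SpecRingedSpace A).presheaf.germ ⊤ x trivial (specHom A a) =
      algebraMap A ((Spec.structureSheaf A).presheaf.stalk x) a :=
  rfl

lemma germ_toFun_specHom (U : Opens (SpecRingedSpace A)) (x : PrimeSpectrum A) (hx : x ∈ U)
    (a : A) : (SpecRingedSpace A).presheaf.germ U x hx (toFun (specHom A) U a) =
      algebraMap A ((Spec.structureSheaf A).presheaf.stalk x) a :=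
  (TopCat.Presheaf.germ_res_apply (SpecRingedSpace A).presheaf (homOfLE (le_top (a := U))) x hx
    (specHom A a)).trans (germ_specHom x a)

lemma stalksFlat_specHom : StalksFlat (specHom A) := fun (x : PrimeSpectrum A) => by
  have : Module.Flat A ((Spec.structureSheaf A).presheaf.stalk x) :=
    IsLocalization.flat _ x.asIdeal.primeCompl
  exact (RingHom.flat_algebraMap_iff (R := A)
    (S := (Spec.structureSheaf A).presheaf.stalk x)).2 this

/-- The stalk is a localization of A, so the germ is a fraction n/d. Both the invertibility of `d`
and the identity clearing it spread from the stalk to a neighbourhood. -/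
lemma locallyFraction_specHom : LocallyFraction (specHom A) := fun U a (x : PrimeSpectrum A) hx => by
  obtain ⟨⟨n, d⟩, h⟩ := IsLocalization.surj x.asIdeal.primeCompl
    (S := (Spec.structureSheaf A).presheaf.stalk x)
    ((SpecRingedSpace A).presheaf.germ U x hx a)
  have hd : IsUnit ((SpecRingedSpace A).presheaf.germ U x hx (toFun (specHom A) U d)) := by
    rw [germ_toFun_specHom]
    exact IsLocalization.map_units ((Spec.structureSheaf A).presheaf.stalk x) d
  obtain ⟨V, i, hxV, hV⟩ := (SpecRingedSpace A).isUnit_res_of_isUnit_germ U _ x hx hd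
  have hg : (SpecRingedSpace A).presheaf.germ U x hx
      (show (SpecRingedSpace A).presheaf.obj (op U) from a * toFun (specHom A) U d) =
      (SpecRingedSpace A).presheaf.germ U x hx (toFun (specHom A) U n) := by
    rw [germ_toFun_specHom]
    refine Eq.trans (map_mul ((SpecRingedSpace A).presheaf.germ U x hx).hom _ _) ?_
    refine Eq.trans ?_ h
    congr 1
    exact germ_toFun_specHom U x hx d
  obtain ⟨W, hxW, i₁, i₂, hW⟩ := (SpecRingedSpace A).presheaf.germ_eq x hx hx _ _ hg
  refine ⟨V ⊓ W, inf_le_right.trans (leOfHom i₁), ⟨hxV, hxW⟩, d, n, ?_, ?_⟩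
  · refine isUnit_toFun inf_le_left (U := V) ?_
    rw [← resFun_toFun _ (leOfHom i)]
    exact hV
  · have hW' : resFun (leOfHom i₁) (a * toFun (specHom A) U d) =
        resFun (leOfHom i₁) (toFun (specHom A) U n) := hW
    rw [← resFun_toFun (specHom A) (inf_le_right.trans (leOfHom i₁)), ← resFun_mul,
      ← resFun_resFun (leOfHom i₁) inf_le_right, hW', resFun_resFun, resFun_toFun]

end Spec

/-! ### Flatness of the ring of global sections -/

/-- The map from A to the stalk at `x` is the flat map to the stalk at f(x) followed by the flat
stalk map. -/
lemma StalksFlat.pullbackHom {X Y : RingedSpace.{u, u}} {f : X ⟶ Y} (hf : IsFlat f) {A : Type u}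
    [CommRing A] {φ : A →+* Fun Y ⊤} (hφ : StalksFlat φ) : StalksFlat (pullbackHom f φ) := by
  intro x
  have h := (hφ (f.hom.base x)).comp (hf x)
  convert h using 1
  ext a
  exact (PresheafedSpace.stalkMap_germ_apply f.hom ⊤ x trivial (φ a)).symm

/-- If `f : X ⟶ Spec A` is flat and the first cohomology of the inverse images of the cokernels of
matrices over `A` vanishes, then `A → Γ(X, 𝒪_X)` is flat. -/
theorem flat_globalSectionsMap {A : Type u} [CommRing A] [IsNoetherianRing A]
    {X : RingedSpace.{u, u}} (f : X ⟶ SpecRingedSpace A) (hf : IsFlat f)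
    (H : ∀ (I J : Type u) [Fintype I] [Fintype J] (M : Matrix J I A),
      Subsingleton (Cohomology ((pullback f).obj (cokernel (mat (specHom A) M))) 1)) :
    (globalSectionsMap f).Flat := by
  have hφ : StalksFlat (pullbackHom f (specHom A)) := stalksFlat_specHom.pullbackHom hf
  algebraize [globalSectionsMap f]
  change Module.Flat A (X.presheaf.obj (op ⊤))
  rw [Module.Flat.iff_forall_isTrivialRelation]
  intro l a b hab
  let M : Matrix (ULift.{u} (Fin l)) PUnit.{u + 1} A := Matrix.of fun i _ => a i.down
  -- Three syzygy steps are needed: `N` for the solutions, `P` to cover the kernel of `N`, and `Q`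
  -- to present that kernel as a cokernel, which commutes with inverse image.
  obtain ⟨I₂, _, N, hNM, hM⟩ := M.exists_rows_span_ker
  obtain ⟨I₃, _, P, hPN, hN⟩ := N.exists_rows_span_ker
  obtain ⟨I₄, _, Q, hQP, hP⟩ := P.exists_rows_span_ker
  obtain ⟨p, hp, _, hE⟩ := exists_presentation_pullback_cokernel f (specHom A) Q
  have := H _ _ Q
  have hΓ (c : A) : toFun (pullbackHom f (specHom A)) ⊤ c = globalSectionsMap f c :=
    resFun_self _
  obtain ⟨t, ht⟩ := hφ.exists_global_vecMul_eq hNM hPN hQP hM hN hP hE (fun i => b i.down) (by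
    ext _
    refine Eq.trans ?_ hab
    simp only [vecMul, dotProduct, Matrix.map_apply, hΓ]
    refine (Fintype.sum_equiv Equiv.ulift _ _ fun i => ?_)
    exact Fun.mul_comm _ _)
  let e := Fintype.equivFin I₂
  -- The relation is trivial because b = tN and NM = 0.
  refine ⟨Fintype.card I₂, fun i j => N (e.symm j) ⟨i⟩, fun j => t (e.symm j), fun i => ?_,
    fun j => ?_⟩
  · refine (congrFun ht ⟨i⟩).symm.trans ?_
    simp only [vecMul, dotProduct, Matrix.map_apply, hΓ]
    refine Fintype.sum_equiv e _ _ fun j => ?_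
    rw [Equiv.symm_apply_apply]
    exact Fun.mul_comm _ _
  · have h := congrFun (congrFun hNM (e.symm j)) PUnit.unit
    refine Eq.trans ?_ h
    rw [Matrix.mul_apply]
    exact Fintype.sum_equiv Equiv.ulift.symm _ _ fun i => mul_comm _ _

end RingedSpaceModules

end

theorem theorem2p8 (A : Type u) [CommRing A] [IsNoetherianRing A] (X : RingedSpace.{u, u})
    (f : X ⟶ RingedSpaceModules.SpecRingedSpace A) (hf : RingedSpaceModules.IsFlat f) :
    ((∀ F : RingedSpaceModules.OModule (RingedSpaceModules.SpecRingedSpace A),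
        RingedSpaceModules.IsQuasiCoherent F →
        Subsingleton (RingedSpaceModules.Cohomology ((RingedSpaceModules.pullback f).obj F) 1)) →
      (RingedSpaceModules.globalSectionsMap f).Flat) ∧
    ((∀ F : RingedSpaceModules.OModule (RingedSpaceModules.SpecRingedSpace A),
        RingedSpaceModules.IsCoherent F →
        Subsingleton (RingedSpaceModules.Cohomology ((RingedSpaceModules.pullback f).obj F) 1)) →
      (RingedSpaceModules.globalSectionsMap f).Flat) := by
  open RingedSpaceModules in
  exact ⟨fun H => flat_globalSectionsMap f hf fun _ _ _ _ M => H _ (isQuasiCoherent_cokernel M),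
    fun H => flat_globalSectionsMap f hf fun _ _ _ _ M =>
      H _ (stalksFlat_specHom.isCoherent_cokernel locallyFraction_specHom M)⟩
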